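/- Let $F$ be a commutative field with $\operatorname{char} F\neq 2$, and let $\pi$ be a projective polarity of $\mathrm{PG}(3,F)$ without self-conjugate points (so $\pi$ is the orthogonality $T\mapsto T^{\pi}$ of a symmetric bilinear form $B$ on $F^4$ with $B(x,x)\ne 0$ for all $x\neq 0$). For lines $a,b$ write $a\approx b$ if $a\cap b^{\pi}\neq\emptyset$ and $a\cap b\neq\emptyset$, and call $a,b$ Clifford parallel if at least three lines $x$ satisfy $x\approx a$ and $x\approx b$. Suppose that there are Clifford parallel lines $a,b$ with $b\notin\{a,a^{\pi}\}$. Let $\gamma$ be the Klein mapping, which takes a line of $\mathrm{PG}(3,F)$ to the point of $\mathrm{PG}(5,F)$ given by its Plücker coordinates, let $\Gamma=\operatorname{im}\gamma$ be the Klein quadric, and let $\kappa$ be the polarity of $\Gamma$. Let $\alpha$ be the projective collineation of $\mathrm{PG}(5,F)$ with $\alpha(\gamma(a))=\gamma(a^{\pi})$ for all lines $a$. Let $\mathcal E_L$ and $\mathcal E_R$ (labelled in either order) be the two skew planes of $\mathrm{PG}(5,F)$ whose union is the set of all $\alpha$-invariant points, and let $\kappa_L$, $\kappa_R$ be the polarities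 that $\kappa$ induces in $\mathcal E_L$, $\mathcal E_R$: two points of the plane are conjugate if they are $\kappa$-conjugate. Call two collineations $\zeta:\mathcal E_L\to\mathcal E_L$ and $\eta:\mathcal E_R\to\mathcal E_R$ (bijections on the points that map lines to lines in both directions) admissible if 1. $\zeta$ commutes with $\kappa_L$ and $\eta$ commutes with $\kappa_R$; and 2. for all points $X\in\mathcal E_L$ and $Y\in\mathcal E_R$: if the line $X\vee Y$ meets $\Gamma$, then the line $X^{\zeta}\vee Y^{\eta}$ meets $\Gamma$. Proposition. If collineations $\zeta:\mathcal E_L\to\mathcal E_L$ and $\eta:\mathcal E_R\to\mathcal E_R$ are admissible, then their inverses $\zeta^{-1}$ and $\eta^{-1}$ are also admissible. -/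

import Mathlib

open scoped LinearAlgebra.Projectivization

namespace EllipticSpace

/-- Lines of `PG(3, F)`: the two-dimensional subspaces of `F⁴`. -/
abbrev Line (F : Type*) [Field F] :=
  {a : Submodule F (Fin 4 → F) // Module.finrank F a = 2}

/-! ### Elliptic 3-spaces

The absolute polarity `π` is the projective polarity `T ↦ B.orthogonal T` of a bilinear form `B`
on `F⁴`. -/

section Elliptic

variable {F : Type*} [Field F] (B : LinearMap.BilinForm F (Fin 4 → F))

/-- `a ≈ b` (orthogonally intersecting lines): `a ∩ b^π ≠ ∅` and `a ∩ b ≠ ∅` as point sets. -/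
def OrthMeet (a b : Line F) : Prop :=
  a.1 ⊓ B.orthogonal b.1 ≠ ⊥ ∧ a.1 ⊓ b.1 ≠ ⊥

/-- Clifford parallel lines: at least three lines meet both `a` and `b` orthogonally. -/
def CliffordParallel (a b : Line F) : Prop :=
  3 ≤ {x : Line F | OrthMeet B x a ∧ OrthMeet B x b}.encard

/-- `(PG(3, F), π)` is a classical elliptic space, where `π` is the orthogonality of `B`. -/
structure IsClassicalElliptic : Prop where
  /-- The characteristic is not two. -/
  char_ne_two : ringChar F ≠ 2
  /-- `π` is a polarity. (A polarity without self-conjugate points cannot be null.) -/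
  symm : B.IsSymm
  /-- `π` is elliptic: no point is conjugate to itself. -/
  anisotropic : ∀ x, B x x = 0 → x = 0
  /-- There are Clifford parallel lines `a`, `b` with `b ∉ {a, a^π}`. -/
  exists_parallel : ∃ a b : Line F, CliffordParallel B a b ∧ b ≠ a ∧ b.1 ≠ B.orthogonal a.1

end Elliptic

/-! ### The Klein quadric in `PG(5, F)` -/

section Klein

variable {F : Type*} [Field F]

/-- The coordinates `(p₀₁, p₀₂, p₀₃, p₂₃, p₃₁, p₁₂)` of an alternating `4 × 4` matrix. -/
def coords (M : Matrix (Fin 4) (Fin 4) F) : Fin 6 → F :=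
  ![M 0 1, M 0 2, M 0 3, M 2 3, M 3 1, M 1 2]

/-- The alternating matrix with given coordinates `(p₀₁, p₀₂, p₀₃, p₂₃, p₃₁, p₁₂)`. -/
def altMatrix (p : Fin 6 → F) : Matrix (Fin 4) (Fin 4) F :=
  !![    0,   p 0,  p 1,  p 2;
      -p 0,     0,  p 5, -p 4;
      -p 1,  -p 5,    0,  p 3;
      -p 2,   p 4, -p 3,    0]

/-- The Plücker vector of a pair of vectors: its entries are `xᵢ yⱼ - xⱼ yᵢ`. -/
def plucker (x y : Fin 4 → F) : Fin 6 → F :=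
  coords (Matrix.of fun i j => x i * y j - x j * y i)

/-- The Klein mapping `γ`; a point of `PG(5, F)` is given by its subspace of `F⁶`. -/
def kleinMap (a : Line F) : Submodule F (Fin 6 → F) :=
  Submodule.span F {p | ∃ x ∈ a.1, ∃ y ∈ a.1, p = plucker x y}

/-- The Klein quadric `Γ`: the image of the Klein mapping. -/
def kleinQuadric (F : Type*) [Field F] : Set (ℙ F (Fin 6 → F)) :=
  {P | ∃ a : Line F, P.submodule = kleinMap a}

/-- The quadratic form of the Klein quadric. -/
def kleinForm (p : Fin 6 → F) : F := p 0 * p 3 + p 1 * p 4 + p 2 * p 5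

/-- Conjugacy of vectors with respect to the polarity `κ` of the Klein quadric. -/
def KleinConj (p q : Fin 6 → F) : Prop := QuadraticMap.polar kleinForm p q = 0

/-- The matrix of a bilinear form on `F⁴`. -/
def gram (B : LinearMap.BilinForm F (Fin 4 → F)) : Matrix (Fin 4) (Fin 4) F :=
  Matrix.of fun i j => B (Pi.single i 1) (Pi.single j 1)

/-- The linear map of `F⁶` that induces the collineation `α` of `PG(5, F)` with
`α (γ a) = γ (a^π)` for all lines `a`: with `G` the matrix of `B`, it takes the Plücker
coordinates of `x ∧ y` to those of `Gx ∧ Gy`, read as dual coordinates of the line with the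
equations `Gx` and `Gy`, that is, up to exchanging the entries `pᵢⱼ` and `pₖₗ`. -/
def alphaMap (B : LinearMap.BilinForm F (Fin 4 → F)) : (Fin 6 → F) →ₗ[F] (Fin 6 → F) where
  toFun p i := coords (gram B * altMatrix p * (gram B).transpose) (i + 3)
  map_add' p q := by
    have h : altMatrix (p + q) = altMatrix p + altMatrix q := by
      ext i j; fin_cases i <;> fin_cases j <;> simp [altMatrix] <;> ring
    ext i
    rw [h]
    fin_cases i <;> simp [coords, Matrix.mul_add, Matrix.add_mul]
  map_smul' c p := by
    have h : altMatrix (c • p) = c • altMatrix p := by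
      ext i j; fin_cases i <;> fin_cases j <;> simp [altMatrix]
    ext i
    rw [h]
    fin_cases i <;> simp [coords]

/-- `EL` and `ER` are the two skew planes formed by all `α`-invariant points of `PG(5, F)`. -/
structure IsInvariantPlanes (B : LinearMap.BilinForm F (Fin 4 → F))
    (EL ER : Submodule F (Fin 6 → F)) : Prop where
  finrank_left : Module.finrank F EL = 3
  finrank_right : Module.finrank F ER = 3
  skew : Disjoint EL ER
  invariant_iff : ∀ P : ℙ F (Fin 6 → F),
    P.submodule.map (alphaMap B) = P.submodule ↔ P.submodule ≤ EL ∨ P.submodule ≤ ER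

end Klein

/-! ### Collineations of planes in `PG(5, F)` -/

section Planes

variable {F : Type*} [Field F]

/-- A set of points of the projective space on `E` is a line. -/
def IsLineSet {E : Submodule F (Fin 6 → F)} (l : Set (ℙ F E)) : Prop :=
  ∃ U : Submodule F E, Module.finrank F U = 2 ∧ l = {X | X.submodule ≤ U}

/-- A permutation of the points of a plane is a collineation if it maps lines to lines, in both
directions. -/
def IsCollineation {E : Submodule F (Fin 6 → F)} (f : Equiv.Perm (ℙ F E)) : Prop :=
  ∀ l : Set (ℙ F E), IsLineSet (f '' l) ↔ IsLineSet l

/-- The polarity induced by `κ` in the plane `E`, on sets of points: the points of `E`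
that are `κ`-conjugate to all points of `S`. -/
def inducedPolar {E : Submodule F (Fin 6 → F)} (S : Set (ℙ F E)) : Set (ℙ F E) :=
  {Y | ∀ X ∈ S, ∀ x ∈ X.submodule, ∀ y ∈ Y.submodule, KleinConj (x : Fin 6 → F) y}

/-- `f` commutes with the polarity that `κ` induces in the plane `E`. -/
def CommutesWithPolarity {E : Submodule F (Fin 6 → F)} (f : Equiv.Perm (ℙ F E)) : Prop :=
  ∀ S : Set (ℙ F E), f '' inducedPolar S = inducedPolar (f '' S)

/-- The join `X ∨ Y`, a subspace of `F⁶`. -/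
def join {EL ER : Submodule F (Fin 6 → F)} (X : ℙ F EL) (Y : ℙ F ER) :
    Submodule F (Fin 6 → F) :=
  X.submodule.map EL.subtype ⊔ Y.submodule.map ER.subtype

/-- `T ∩ Γ ≠ ∅` for the subspace `T` of `PG(5, F)`. -/
def MeetsKlein (T : Submodule F (Fin 6 → F)) : Prop :=
  ∃ P ∈ kleinQuadric F, P.submodule ≤ T

/-- Admissible pairs of collineations. -/
structure Admissible {EL ER : Submodule F (Fin 6 → F)}
    (ζ : Equiv.Perm (ℙ F EL)) (η : Equiv.Perm (ℙ F ER)) : Prop where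
  collineation_left : IsCollineation ζ
  collineation_right : IsCollineation η
  commutes_left : CommutesWithPolarity ζ
  commutes_right : CommutesWithPolarity η
  meets : ∀ X Y, MeetsKlein (join X Y) → MeetsKlein (join (ζ X) (η Y))

end Planes

end EllipticSpace

/-! Write q for the polar form of the Klein quadric evaluated on the diagonal. The planes `EL` and
`ER` are κ-polar to each other and q is anisotropic on both, so q is diagonal on the join of X and
Y, and X ∨ Y meets Γ exactly when -q(X)q(Y) is a square (`IsInvariantPlanes.meetsKlein_join_iff`).
For fixed Y the admissible X therefore form one square class of points, which is nonempty because Γ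
contains planes (`IsInvariantPlanes.exists_meetsKlein_join`).

A bijection of the points of `EL` that commutes with κ_L respects orthogonality in both directions,
hence also the relation "same square class" (`CommutesWithPolarity.isSquare`). No semilinear
representation is needed: after rescaling, two points of one class are z + w and z - w with z ⟂ w,
and harmonic position survives by a quadrilateral construction (`isSquare_map_add_sub`).

So if X ∨ Y meets Γ, choose X₀ joined to η⁻¹Y by a line meeting Γ. By admissibility ζX₀ and X lie in
the same class, hence so do X₀ and ζ⁻¹X, and ζ⁻¹X ∨ η⁻¹Y meets Γ. -/

namespace EllipticSpace

/-! ### Orthogonality-preserving maps of anisotropic spaces -/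

section Orthogonality

variable {F V : Type*} [Field F] [AddCommGroup V] [Module F V] {b : LinearMap.BilinForm F V}
  {f : V → V}

theorem eq_zero_iff_of_anisotropic (hb : ∀ x, b x x = 0 → x = 0)
    (hf : ∀ u v, b (f u) (f v) = 0 ↔ b u v = 0) (v : V) : f v = 0 ↔ v = 0 := by
  constructor
  · intro h
    exact hb v ((hf v v).1 (by simp [h]))
  · rintro rfl
    exact hb _ ((hf 0 0).2 (by simp))

/-- A map that respects orthogonality in both directions respects linear independence. -/
theorem linearIndependent_pair_map (hb : ∀ x, b x x = 0 → x = 0)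
    (hf : ∀ u v, b (f u) (f v) = 0 ↔ b u v = 0) {u v : V} (h : LinearIndependent F ![u, v]) :
    LinearIndependent F ![f u, f v] := by
  have hu : u ≠ 0 := h.ne_zero 0
  rw [LinearIndependent.pair_iff' ((eq_zero_iff_of_anisotropic hb hf u).not.2 hu)]
  intro c hc
  have hq : b u u ≠ 0 := fun h0 => hu (hb u h0)
  -- A multiple of the component of v orthogonal to u; if f v is a multiple of f u, then w is also
  -- orthogonal to v, hence to itself.
  set w := (b u u) • v - (b u v) • u with hw
  have huw : b u w = 0 := by simp [hw, mul_comm]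
  have hvw : b v w = 0 := by
    rw [← hf, ← hc, map_smul, LinearMap.smul_apply, (hf u w).2 huw, smul_zero]
  have hw0 : w = 0 := by
    apply hb
    have hwx : ∀ x, b w x = b u u * b v x - b u v * b u x := by simp [hw]
    rw [hwx, huw, hvw]
    ring
  have := LinearIndependent.pair_iff.1 h (-(b u v)) (b u u) (by rw [← hw0, hw]; module)
  exact hq this.2

/-- In dimension three, a map that respects orthogonality in both directions respects
collinearity. -/
theorem map_mem_span_pair (hd : Module.finrank F V = 3) (hs : b.IsSymm)
    (hb : ∀ x, b x x = 0 → x = 0)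
    (hf : ∀ u v, b (f u) (f v) = 0 ↔ b u v = 0) {u v r : V} (h : LinearIndependent F ![u, v])
    (hr : r ∈ Submodule.span F {u, v}) : ∃ s t : F, s • f u + t • f v = f r := by
  have : FiniteDimensional F V := FiniteDimensional.of_finrank_pos (by omega)
  -- The line through u and v is the polar of l, so its image lies in the polar of f l, which is
  -- again a line.
  obtain ⟨l, hl, hl0⟩ : ∃ l ∈ LinearMap.ker ((b u).prod (b v)), l ≠ 0 := by
    apply Submodule.exists_mem_ne_zero_of_ne_bot
    apply LinearMap.ker_ne_bot_of_finrank_lt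
    simp [hd]
  have hl : b u l = 0 ∧ b v l = 0 := by simpa using hl
  have hsym : ∀ x y, b x y = b y x := hs.eq
  have hrl : b r l = 0 := by
    obtain ⟨s, t, rfl⟩ := Submodule.mem_span_pair.1 hr
    simp [hl]
  have hfl : b (f l) (f l) ≠ 0 := fun h0 => hl0 (hb l ((hf l l).1 h0))
  have hle : Submodule.span F {f u, f v} ≤ LinearMap.ker (b (f l)) := by
    rw [Submodule.span_le]
    rintro x (rfl | rfl)
    · simpa [hsym (f l)] using (hf u l).2 hl.1
    · simpa [hsym (f l)] using (hf v l).2 hl.2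
  have h2 : Module.finrank F (Submodule.span F {f u, f v}) = 2 := by
    have := finrank_span_eq_card (linearIndependent_pair_map hb hf h)
    rwa [Matrix.range_cons_cons_empty, Fintype.card_fin] at this
  have hker : Module.finrank F (LinearMap.ker (b (f l))) < 3 := by
    rw [← hd]
    apply Submodule.finrank_lt
    intro htop
    exact hfl (LinearMap.mem_ker.1 (htop ▸ Submodule.mem_top))
  have heq := Submodule.eq_of_le_of_finrank_le hle (by omega)
  rw [← Submodule.mem_span_pair, heq, LinearMap.mem_ker, hsym]
  exact (hf r l).2 hrl

theorem linearIndependent_pair_of_orthogonal (hb : ∀ x, b x x = 0 → x = 0) {u v : V}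
    (hu : u ≠ 0) (hv : v ≠ 0) (huv : b u v = 0) : LinearIndependent F ![u, v] := by
  rw [LinearIndependent.pair_iff' hu]
  rintro c rfl
  have hc : c ≠ 0 := by rintro rfl; simp at hv
  refine hu (hb u ?_)
  simpa [hc] using huv

/-- Two vectors `z + w` and `z - w` with `z ⟂ w` are mapped to vectors of the same square class,
since their images are harmonic with respect to the images of `z` and `w`. -/
theorem isSquare_map_add_sub (hd : Module.finrank F V = 3) (hs : b.IsSymm)
    (hb : ∀ x, b x x = 0 → x = 0) (hf : ∀ u v, b (f u) (f v) = 0 ↔ b u v = 0)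
    {z w : V} (hz : z ≠ 0) (hw : w ≠ 0) (hzw : b z w = 0) :
    IsSquare (b (f (z + w)) (f (z + w)) * b (f (z - w)) (f (z - w))) := by
  have : FiniteDimensional F V := FiniteDimensional.of_finrank_pos (by omega)
  -- The points n + z, n + w and n + z + w form with n, z, w the quadrilateral that constructs z -
  -- w, on the line through n + z and n + w, from z + w.
  obtain ⟨n, hn, hn0⟩ : ∃ n ∈ LinearMap.ker ((b z).prod (b w)), n ≠ 0 := by
    apply Submodule.exists_mem_ne_zero_of_ne_bot
    apply LinearMap.ker_ne_bot_of_finrank_lt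
    simp [hd]
  have hn : b z n = 0 ∧ b w n = 0 := by simpa using hn
  have hsym : ∀ x y, b x y = b y x := hs.eq
  have hq : ∀ {x}, x ≠ 0 → b x x ≠ 0 := fun hx h0 => hx (hb _ h0)
  have hwz : b w z = 0 := by rw [hsym, hzw]
  have hnz : b n z = 0 := by rw [hsym, hn.1]
  have hnw : b n w = 0 := by rw [hsym, hn.2]
  have hx0 : z + w ≠ 0 := by
    intro h0
    apply hq hz
    have : b z (z + w) = 0 := by simp [h0]
    simpa [hzw] using this
  have hnz0 : n + z ≠ 0 := by
    intro h0
    apply hq hn0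
    have : b n (n + z) = 0 := by simp [h0]
    simpa [hnz] using this
  have hnw0 : n + w ≠ 0 := by
    intro h0
    apply hq hn0
    have : b n (n + w) = 0 := by simp [h0]
    simpa [hnw] using this
  have key := @map_mem_span_pair F V _ _ _ b f hd hs hb hf
  obtain ⟨a1, a2, ha⟩ := key (linearIndependent_pair_of_orthogonal hb hz hw hzw)
    (Submodule.mem_span_pair.2 ⟨1, 1, by module⟩ : z + w ∈ _)
  obtain ⟨c1, c2, hc⟩ := key (linearIndependent_pair_of_orthogonal hb hz hw hzw)
    (Submodule.mem_span_pair.2 ⟨1, -1, by module⟩ : z - w ∈ _)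
  obtain ⟨d1, d2, hd⟩ := key (linearIndependent_pair_of_orthogonal hb hn0 hz hnz)
    (Submodule.mem_span_pair.2 ⟨1, 1, by module⟩ : n + z ∈ _)
  obtain ⟨e1, e2, he⟩ := key (linearIndependent_pair_of_orthogonal hb hn0 hw hnw)
    (Submodule.mem_span_pair.2 ⟨1, 1, by module⟩ : n + w ∈ _)
  obtain ⟨g1, g2, hg⟩ := key
    (linearIndependent_pair_of_orthogonal hb hn0 hx0 (by simp [hnz, hnw]))
    (Submodule.mem_span_pair.2 ⟨1, 1, by module⟩ : n + z + w ∈ _)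
  obtain ⟨k1, k2, hk⟩ := key
    (linearIndependent_pair_of_orthogonal hb hnz0 hw (by simp [hzw, hnw]))
    (Submodule.mem_span_pair.2 ⟨1, 1, by module⟩ : n + z + w ∈ _)
  obtain ⟨m1, m2, hm⟩ := key
    (linearIndependent_pair_of_orthogonal hb hnw0 hz (by simp [hwz, hnz]))
    (Submodule.mem_span_pair.2 ⟨1, 1, by module⟩ : n + z + w ∈ _)
  have hli : LinearIndependent F ![n + z, n + w] := by
    rw [LinearIndependent.pair_iff]
    intro s t hst
    have h1 : b z (s • (n + z) + t • (n + w)) = 0 := by rw [hst, map_zero]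
    have h2 : b w (s • (n + z) + t • (n + w)) = 0 := by rw [hst, map_zero]
    simp only [map_add, map_smul, hn.1, hn.2, hzw, hwz, zero_add, add_zero, mul_zero,
      smul_eq_mul, mul_eq_zero, hq hz, hq hw, or_false] at h1 h2
    exact ⟨h1, h2⟩
  obtain ⟨s, t, hst⟩ := key hli (Submodule.mem_span_pair.2 ⟨1, -1, by module⟩ : z - w ∈ _)
  have hZW := (hf z w).2 hzw
  have hWZ := (hf w z).2 hwz
  have hNZ := (hf n z).2 hnz
  have hNW := (hf n w).2 hnw
  have hZN := (hf z n).2 hn.1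
  have hWN := (hf w n).2 hn.2
  have hZ : b (f z) (f z) ≠ 0 := (hf z z).not.2 (hq hz)
  have hW : b (f w) (f w) ≠ 0 := (hf w w).not.2 (hq hw)
  have hN : b (f n) (f n) ≠ 0 := (hf n n).not.2 (hq hn0)
  -- A vanishing coefficient would make an image orthogonal to f n or f z, although the vectors
  -- themselves are not orthogonal.
  have ha1 : a1 ≠ 0 := by
    rintro rfl
    have := (hf z (z + w)).1 (by rw [← ha]; simp [hZW])
    exact hq hz (by simpa [hzw] using this)
  have hd1 : d1 ≠ 0 := by
    rintro rfl
    have := (hf n (n + z)).1 (by rw [← hd]; simp [hNZ])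
    exact hq hn0 (by simpa [hnz] using this)
  have he1 : e1 ≠ 0 := by
    rintro rfl
    have := (hf n (n + w)).1 (by rw [← he]; simp [hNW])
    exact hq hn0 (by simpa [hnw] using this)
  have hk1 : g1 ≠ 0 := by
    rintro rfl
    have := (hf n (n + z + w)).1 (by rw [← hg, ← ha]; simp [hNW, hNZ])
    exact hq hn0 (by simpa [hnw, hnz] using this)
  have hg2 : g2 ≠ 0 := by
    rintro rfl
    have := (hf z (n + z + w)).1 (by rw [← hg]; simp [hZN])
    exact hq hz (by simpa [hzw, hn.1] using this)
  rw [← hg, ← ha, ← hd] at hk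
  rw [← hg, ← ha, ← he] at hm
  rw [← hc, ← hd, ← he] at hst
  -- The images of n, z, w are pairwise orthogonal and non-isotropic, so pairing with them compares
  -- coefficients.
  have k1' := congrArg (b (f n)) hk
  have k2' := congrArg (b (f z)) hk
  have m1' := congrArg (b (f n)) hm
  have m2' := congrArg (b (f w)) hm
  have s1 := congrArg (b (f n)) hst
  have s2 := congrArg (b (f z)) hst
  have s3 := congrArg (b (f w)) hst
  simp only [map_add, map_smul, hZW, hWZ, hNZ, hNW, hZN, hWN, smul_eq_mul, mul_zero, add_zero,
    zero_add, ← mul_assoc, mul_left_inj' hN, mul_left_inj' hZ, mul_left_inj' hW,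
    mul_eq_zero, hN, or_false, ← add_mul] at k1' k2' m1' m2' s1 s2 s3
  -- Harmonicity: f (z - w) is a multiple of a1 • f z - a2 • f w.
  have hcross : c1 * a2 = -(c2 * a1) := by
    have e1' : g1 * d2 = g2 * a1 * d1 := by rw [← k1', ← k2']; ring
    have e2' : g1 * e2 = g2 * a2 * e1 := by rw [← m1', ← m2']; ring
    have : (g1 * g2 * d1 * e1) * (c1 * a2 + c2 * a1) = 0 := by
      rw [← s2, ← s3]
      linear_combination -(s * d2 * g1 * d1) * e2'
        - (t * e2 * g1 * e1) * e1' + (g1 * g1 * d2 * e2) * s1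
    have := (mul_eq_zero.1 this).resolve_left (by positivity)
    linear_combination this
  refine ⟨c1 / a1 * b (f (z + w)) (f (z + w)), ?_⟩
  have hc2 : c2 = -(c1 / a1) * a2 := by field_simp; linear_combination hcross
  have : b (f (z - w)) (f (z - w)) = (c1 / a1) ^ 2 * b (f (z + w)) (f (z + w)) := by
    rw [← ha, ← hc, hc2]
    simp [hZW, hWZ]
    field_simp
  rw [this]; ring

/-- In an anisotropic space of dimension three, maps of points that respect orthogonality in both
directions respect the relation of vectors to have the same square class. -/
theorem isSquare_map_mul_map (h2 : (2 : F) ≠ 0) (hd : Module.finrank F V = 3) (hs : b.IsSymm)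
    (hb : ∀ x, b x x = 0 → x = 0) (hf : ∀ u v, b (f u) (f v) = 0 ↔ b u v = 0)
    (hc : ∀ (c : F) (v : V), c ≠ 0 → f (c • v) = f v) {x y : V}
    (h : IsSquare (b x x * b y y)) : IsSquare (b (f x) (f x) * b (f y) (f y)) := by
  by_cases hx : x = 0
  · simp [(eq_zero_iff_of_anisotropic hb hf x).2 hx]
  by_cases hy : y = 0
  · simp [(eq_zero_iff_of_anisotropic hb hf y).2 hy]
  obtain ⟨r, hr⟩ := h
  have hqx : b x x ≠ 0 := fun h0 => hx (hb _ h0)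
  have hqy : b y y ≠ 0 := fun h0 => hy (hb _ h0)
  have hr0 : r ≠ 0 := by rintro rfl; simp_all
  have hsym : ∀ x y, b x y = b y x := hs.eq
  -- This multiple y' of y satisfies b y' y' = b x x, so half the sum and half the difference of x
  -- and y' are orthogonal.
  rw [← hc (r / b y y) y (by positivity)]
  set y' := (r / b y y) • y with hy'
  have hyy : b y' y' = b x x := by
    simp only [hy', map_smul, LinearMap.smul_apply, smul_eq_mul]
    field_simp
    linear_combination -hr
  set z := (2⁻¹ : F) • (x + y') with hz
  set w := (2⁻¹ : F) • (x - y') with hw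
  have hx' : z + w = x := by
    rw [hz, hw, ← smul_add, add_add_sub_cancel, ← two_smul F x, smul_smul, inv_mul_cancel₀ h2,
      one_smul]
  have hy'' : z - w = y' := by
    rw [hz, hw, ← smul_sub, add_sub_sub_cancel, ← two_smul F y', smul_smul, inv_mul_cancel₀ h2,
      one_smul]
  have hzw : b z w = 0 := by
    simp only [hz, hw, map_smul, map_add, map_sub, LinearMap.smul_apply, LinearMap.add_apply,
      hyy, hsym y' x, smul_eq_mul]
    ring
  by_cases hz0 : z = 0
  · have : y' = (-1 : F) • x := by rw [← hx', ← hy'', hz0]; module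
    rw [this, hc _ _ (by simp)]
    exact ⟨_, rfl⟩
  by_cases hw0 : w = 0
  · have : y' = x := by rw [← hx', ← hy'', hw0]; module
    rw [this]
    exact ⟨_, rfl⟩
  have := isSquare_map_add_sub hd hs hb hf hz0 hw0 hzw
  rwa [hx', hy''] at this

end Orthogonality

/-! ### The Klein quadric as the zero set of `kleinForm`, and the action of α -/

section KleinQuadric

open Matrix

variable {F : Type*} [Field F]

/-- The bilinear form of the Klein quadric. -/
def kleinBilin (F : Type*) [Field F] : LinearMap.BilinForm F (Fin 6 → F) :=
  LinearMap.mk₂ F (fun p q => p 0 * q 3 + p 3 * q 0 + p 1 * q 4 + p 4 * q 1 + p 2 * q 5 + p 5 * q 2)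
    (by intros; simp; ring) (by intros; simp; ring) (by intros; simp; ring)
    (by intros; simp; ring)

theorem kleinBilin_apply (p q : Fin 6 → F) : kleinBilin F p q =
    p 0 * q 3 + p 3 * q 0 + p 1 * q 4 + p 4 * q 1 + p 2 * q 5 + p 5 * q 2 := rfl

theorem polar_kleinForm (p q : Fin 6 → F) :
    QuadraticMap.polar kleinForm p q = kleinBilin F p q := by
  simp [QuadraticMap.polar, kleinForm, kleinBilin_apply]
  ring

theorem kleinBilin_self (p : Fin 6 → F) : kleinBilin F p p = 2 * kleinForm p := by
  rw [kleinBilin_apply, kleinForm]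
  ring

theorem kleinBilin_comm (p q : Fin 6 → F) : kleinBilin F p q = kleinBilin F q p := by
  simp only [kleinBilin_apply]
  ring

theorem kleinForm_plucker (x y : Fin 4 → F) : kleinForm (plucker x y) = 0 := by
  simp [kleinForm, plucker, coords]
  ring

theorem plucker_combination (x y : Fin 4 → F) (s t u v : F) :
    plucker (s • x + t • y) (u • x + v • y) = (s * v - t * u) • plucker x y := by
  ext i
  fin_cases i <;> simp [plucker, coords] <;> ring

theorem kleinMap_span_pair (a : Line F) {x y : Fin 4 → F} (h : a.1 = Submodule.span F {x, y}) :
    kleinMap a = Submodule.span F {plucker x y} := by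
  apply le_antisymm
  · rw [kleinMap, Submodule.span_le]
    rintro _ ⟨u, hu, v, hv, rfl⟩
    rw [h, Submodule.mem_span_pair] at hu hv
    obtain ⟨s, t, rfl⟩ := hu
    obtain ⟨s', t', rfl⟩ := hv
    rw [plucker_combination]
    exact Submodule.smul_mem _ _ (Submodule.mem_span_singleton_self _)
  · rw [Submodule.span_singleton_le_iff_mem]
    refine Submodule.subset_span ⟨x, ?_, y, ?_, rfl⟩ <;>
    · rw [h]
      exact Submodule.subset_span (by simp)

theorem kleinForm_eq_zero_of_mem_kleinMap (a : Line F) {p : Fin 6 → F} (hp : p ∈ kleinMap a) :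
    kleinForm p = 0 := by
  have : FiniteDimensional F a.1 := FiniteDimensional.of_finrank_pos (by rw [a.2]; norm_num)
  let e := Module.finBasisOfFinrankEq F a.1 a.2
  have h : a.1 = Submodule.span F {(e 0 : Fin 4 → F), (e 1 : Fin 4 → F)} := by
    have := congrArg (Submodule.map a.1.subtype) e.span_eq
    rw [Submodule.map_span, Submodule.map_top, Submodule.range_subtype] at this
    refine this.symm.trans ?_
    rw [← Set.range_comp]
    congr 1
    ext v
    simp [Fin.exists_fin_two, eq_comm]
  rw [kleinMap_span_pair a h] at hp
  obtain ⟨c, rfl⟩ := Submodule.mem_span_singleton.1 hp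
  have := kleinForm_plucker (e 0 : Fin 4 → F) (e 1)
  simp only [kleinForm, Pi.smul_apply, smul_eq_mul] at this ⊢
  linear_combination c ^ 2 * this

/-- If p is the Plücker vector of x, y, then row i of its matrix is xᵢ y - yᵢ x. Hence two rows with
a nonzero entry pᵢⱼ recover the line from p. -/
theorem plucker_altMatrix_rows {p : Fin 6 → F} (h : kleinForm p = 0) (i j : Fin 4) :
    plucker (altMatrix p i) (altMatrix p j) = altMatrix p i j • p := by
  simp only [kleinForm] at h
  ext k
  fin_cases i <;> fin_cases j <;> fin_cases k <;> simp [plucker, coords, altMatrix] <;>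
    first | ring1 | linear_combination h | linear_combination -h

theorem linearIndependent_of_plucker_ne_zero {x y : Fin 4 → F} (h : plucker x y ≠ 0) :
    LinearIndependent F ![x, y] := by
  have hx : x ≠ 0 := by
    rintro rfl
    apply h
    ext i
    fin_cases i <;> simp [plucker, coords]
  rw [LinearIndependent.pair_iff' hx]
  rintro c rfl
  apply h
  ext i
  fin_cases i <;> simp [plucker, coords] <;> ring

theorem exists_eq_plucker {p : Fin 6 → F} (hp : p ≠ 0) (h : kleinForm p = 0) :
    ∃ x y, p = plucker x y := by
  obtain ⟨i, j, hij⟩ : ∃ i j, altMatrix p i j ≠ 0 := by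
    by_contra! h0
    apply hp
    have h1 := h0 0 1
    have h2 := h0 0 2
    have h3 := h0 0 3
    have h4 := h0 2 3
    have h5 := h0 3 1
    have h6 := h0 1 2
    ext k
    fin_cases k <;> simp_all [altMatrix]
  refine ⟨altMatrix p i, (altMatrix p i j)⁻¹ • altMatrix p j, ?_⟩
  have := plucker_combination (altMatrix p i) (altMatrix p j) 1 0 0 (altMatrix p i j)⁻¹
  rw [plucker_altMatrix_rows h, smul_smul] at this
  simpa [hij] using this.symm

theorem mk_mem_kleinQuadric {p : Fin 6 → F} (hp : p ≠ 0) (h : kleinForm p = 0) :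
    Projectivization.mk F p hp ∈ kleinQuadric F := by
  obtain ⟨x, y, rfl⟩ := exists_eq_plucker hp h
  have hf := finrank_span_eq_card (linearIndependent_of_plucker_ne_zero hp)
  refine ⟨⟨Submodule.span F {x, y}, ?_⟩, ?_⟩
  · rwa [Matrix.range_cons_cons_empty, Fintype.card_fin] at hf
  · rw [kleinMap_span_pair _ rfl, Projectivization.submodule_mk]

theorem meetsKlein_iff {T : Submodule F (Fin 6 → F)} :
    MeetsKlein T ↔ ∃ p ∈ T, p ≠ 0 ∧ kleinForm p = 0 := by
  constructor
  · rintro ⟨P, ⟨a, ha⟩, hP⟩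
    have hr : P.rep ∈ P.submodule := by
      rw [Projectivization.submodule_eq]
      exact Submodule.mem_span_singleton_self _
    exact ⟨P.rep, hP hr, P.rep_nonzero, kleinForm_eq_zero_of_mem_kleinMap a (ha ▸ hr)⟩
  · rintro ⟨p, hp, hp0, h⟩
    refine ⟨_, mk_mem_kleinQuadric hp0 h, ?_⟩
    rw [Projectivization.submodule_mk, Submodule.span_singleton_le_iff_mem]
    exact hp

/-! ### The collineation `α` -/

variable (B : LinearMap.BilinForm F (Fin 4 → F))

theorem alphaMap_apply (p : Fin 6 → F) (i : Fin 6) :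
    alphaMap B p i = coords (gram B * altMatrix p * (gram B)ᵀ) (i + 3) := rfl

/-- `kleinForm p` is the Pfaffian of `altMatrix p`. -/
theorem kleinForm_coords_mul (G : Matrix (Fin 4) (Fin 4) F) (p : Fin 6 → F) :
    kleinForm (coords (G * altMatrix p * Gᵀ)) = G.det * kleinForm p := by
  simp only [kleinForm, coords, altMatrix, Matrix.mul_apply, Fin.sum_univ_four,
    Matrix.det_succ_row_zero, Matrix.transpose_apply, Matrix.of_apply, Matrix.cons_val]
  simp [Fin.sum_univ_succ, Fin.succAbove]
  ring

theorem kleinForm_alphaMap (p : Fin 6 → F) :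
    kleinForm (alphaMap B p) = (gram B).det * kleinForm p := by
  rw [← kleinForm_coords_mul]
  simp only [kleinForm, alphaMap_apply, coords]
  simp
  ring

theorem kleinBilin_alphaMap (p q : Fin 6 → F) :
    kleinBilin F (alphaMap B p) (alphaMap B q) = (gram B).det * kleinBilin F p q := by
  simp only [← polar_kleinForm, QuadraticMap.polar, ← map_add, kleinForm_alphaMap]
  ring

theorem altMatrix_plucker_mulVec (x y w : Fin 4 → F) :
    altMatrix (plucker x y) *ᵥ w = (y ⬝ᵥ w) • x - (x ⬝ᵥ w) • y := by
  ext i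
  fin_cases i <;>
    simp [altMatrix, plucker, coords, Matrix.mulVec, dotProduct, Fin.sum_univ_four] <;> ring

/-- The matrix of a line kills the covectors that vanish on the line; the polar line satisfies the
equation Gx, where G is the matrix of B. -/
theorem altMatrix_alphaMap_plucker_mulVec (x y : Fin 4 → F) :
    altMatrix (alphaMap B (plucker x y)) *ᵥ (gram B *ᵥ x) = 0 := by
  have h : alphaMap B (plucker x y) = fun i => plucker (gram B *ᵥ x) (gram B *ᵥ y) (i + 3) := by
    have : altMatrix (plucker x y) = vecMulVec x y - vecMulVec y x := by
      ext i j
      fin_cases i <;> fin_cases j <;> simp [altMatrix, plucker, coords, vecMulVec] <;> ring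
    have h2 : gram B * altMatrix (plucker x y) * (gram B)ᵀ =
        vecMulVec (gram B *ᵥ x) (gram B *ᵥ y) - vecMulVec (gram B *ᵥ y) (gram B *ᵥ x) := by
      rw [this, Matrix.mul_sub, Matrix.sub_mul, Matrix.mul_vecMulVec, Matrix.mul_vecMulVec,
        Matrix.vecMulVec_mul, Matrix.vecMulVec_mul, Matrix.vecMul_transpose,
        Matrix.vecMul_transpose]
    ext i
    rw [alphaMap_apply, h2, plucker]
    congr 2
    ext i j
    simp [vecMulVec, mul_comm]
  rw [h]
  ext i
  fin_cases i <;> simp [altMatrix, plucker, coords, Matrix.mulVec, dotProduct, Fin.sum_univ_four] <;>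
    ring

theorem dotProduct_gram_mulVec (x : Fin 4 → F) : x ⬝ᵥ gram B *ᵥ x = B x x := by
  have h : gram B = LinearMap.BilinForm.toMatrix' B := rfl
  rw [h, ← Matrix.toBilin'_apply', Matrix.toBilin'_toMatrix']

variable {B}

/-- No `α`-invariant point lies on the Klein quadric. -/
theorem kleinForm_ne_zero_of_alphaMap_eq_smul (hB : ∀ x, B x x = 0 → x = 0) {p : Fin 6 → F}
    (hp : p ≠ 0) {c : F} (hc : c ≠ 0) (h : alphaMap B p = c • p) : kleinForm p ≠ 0 := by
  intro h0
  obtain ⟨x, y, rfl⟩ := exists_eq_plucker hp h0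
  have hli := linearIndependent_of_plucker_ne_zero hp
  -- An invariant point on Γ would be a line equal to its polar line, making x self-conjugate.
  have key := altMatrix_alphaMap_plucker_mulVec B x y
  have hs : altMatrix (c • plucker x y) = c • altMatrix (plucker x y) := by
    ext i j
    fin_cases i <;> fin_cases j <;> simp [altMatrix]
  rw [h, hs, Matrix.smul_mulVec, altMatrix_plucker_mulVec, smul_eq_zero_iff_right hc,
    dotProduct_gram_mulVec, sub_eq_add_neg, ← neg_smul] at key
  have := (LinearIndependent.pair_iff.1 hli _ _ key).2
  exact hli.ne_zero 0 (hB x (neg_eq_zero.1 this))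

end KleinQuadric

/-! ### The two planes of invariant points and their square classes -/

section InvariantPlanes

variable {F : Type*} [Field F] {B : LinearMap.BilinForm F (Fin 4 → F)}
  {EL ER : Submodule F (Fin 6 → F)}

theorem IsInvariantPlanes.symm (hE : IsInvariantPlanes B EL ER) : IsInvariantPlanes B ER EL :=
  ⟨hE.finrank_right, hE.finrank_left, hE.skew.symm, fun P => by rw [hE.invariant_iff, or_comm]⟩

theorem IsInvariantPlanes.exists_alphaMap_eq_smul (hE : IsInvariantPlanes B EL ER)
    {p : Fin 6 → F} (hp : p ∈ EL) (hp0 : p ≠ 0) : ∃ c : F, c ≠ 0 ∧ alphaMap B p = c • p := by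
  have h := (hE.invariant_iff (Projectivization.mk F p hp0)).2
    (.inl (by rwa [Projectivization.submodule_mk, Submodule.span_singleton_le_iff_mem]))
  rw [Projectivization.submodule_mk, Submodule.map_span, Set.image_singleton] at h
  obtain ⟨c, hc⟩ := Submodule.mem_span_singleton.1 (h ▸ Submodule.mem_span_singleton_self _)
  refine ⟨c, ?_, hc.symm⟩
  rintro rfl
  rw [← hc, zero_smul, Submodule.span_zero_singleton, eq_comm,
    Submodule.span_singleton_eq_bot] at h
  exact hp0 h

theorem IsInvariantPlanes.mem_or_mem (hE : IsInvariantPlanes B EL ER) {p : Fin 6 → F} {c : F}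
    (hc : c ≠ 0) (h : alphaMap B p = c • p) : p ∈ EL ∨ p ∈ ER := by
  by_cases hp0 : p = 0
  · simp [hp0]
  have := (hE.invariant_iff (Projectivization.mk F p hp0)).1 (by
    rw [Projectivization.submodule_mk, Submodule.map_span, Set.image_singleton, h,
      Submodule.span_singleton_smul_eq (IsUnit.mk0 c hc)])
  simpa only [Projectivization.submodule_mk, Submodule.span_singleton_le_iff_mem] using this

theorem IsInvariantPlanes.kleinBilin_self_ne_zero (hE : IsInvariantPlanes B EL ER)
    (h2 : (2 : F) ≠ 0) (hB : ∀ x, B x x = 0 → x = 0) {p : Fin 6 → F} (hp : p ∈ EL)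
    (hp0 : p ≠ 0) : kleinBilin F p p ≠ 0 := by
  obtain ⟨c, hc, h⟩ := hE.exists_alphaMap_eq_smul hp hp0
  rw [kleinBilin_self]
  exact mul_ne_zero h2 (kleinForm_ne_zero_of_alphaMap_eq_smul hB hp0 hc h)

/-- The two planes of invariant points are polar to each other. -/
theorem IsInvariantPlanes.kleinBilin_eq_zero (hE : IsInvariantPlanes B EL ER)
    (h2 : (2 : F) ≠ 0) (hB : ∀ x, B x x = 0 → x = 0) {p q : Fin 6 → F} (hp : p ∈ EL)
    (hq : q ∈ ER) : kleinBilin F p q = 0 := by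
  by_contra hpq
  have hp0 : p ≠ 0 := by rintro rfl; simp at hpq
  have hq0 : q ≠ 0 := by rintro rfl; simp at hpq
  obtain ⟨c, hc, h⟩ := hE.exists_alphaMap_eq_smul hp hp0
  obtain ⟨d, hd, h'⟩ := hE.symm.exists_alphaMap_eq_smul hq hq0
  -- With eigenvalues c and d, this gives c² = det G = cd. So c = d, and p + q would be an invariant
  -- point outside both planes.
  have e1 := kleinBilin_alphaMap B p p
  have e2 := kleinBilin_alphaMap B p q
  simp only [h, h', map_smul, LinearMap.smul_apply, smul_eq_mul, ← mul_assoc] at e1 e2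
  have e1' := mul_right_cancel₀ (hE.kleinBilin_self_ne_zero h2 hB hp hp0) e1
  have e2' := mul_right_cancel₀ hpq e2
  have hcd : c = d := mul_left_cancel₀ hc (by rw [e1', ← e2', mul_comm])
  rcases hE.mem_or_mem (p := p + q) hc (by rw [map_add, h, h', hcd, smul_add]) with hm | hm
  · exact hq0 (Submodule.disjoint_def.1 hE.skew q ((Submodule.add_mem_iff_right _ hp).1 hm) hq)
  · exact hp0 (Submodule.disjoint_def.1 hE.skew p hp ((Submodule.add_mem_iff_left _ hq).1 hm))

theorem join_eq_span_pair (X : ℙ F EL) (Y : ℙ F ER) :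
    join X Y = Submodule.span F {(X.rep : Fin 6 → F), (Y.rep : Fin 6 → F)} := by
  rw [join, X.submodule_eq, Y.submodule_eq, Submodule.map_span, Submodule.map_span,
    ← Submodule.span_union, Set.image_singleton, Set.image_singleton, Set.singleton_union]
  rfl

/-- By polarity of the two planes the form is diagonal on the join, and s²q(X) + t²q(Y) has a
nontrivial zero exactly when -q(X)q(Y) is a square. -/
theorem IsInvariantPlanes.meetsKlein_join_iff (hE : IsInvariantPlanes B EL ER)
    (h2 : (2 : F) ≠ 0) (hB : ∀ x, B x x = 0 → x = 0) (X : ℙ F EL) (Y : ℙ F ER) :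
    MeetsKlein (join X Y) ↔
      IsSquare (-(kleinBilin F X.rep X.rep * kleinBilin F Y.rep Y.rep)) := by
  have hX0 : (X.rep : Fin 6 → F) ≠ 0 := by simpa using X.rep_nonzero
  have hY0 : (Y.rep : Fin 6 → F) ≠ 0 := by simpa using Y.rep_nonzero
  have hX := hE.kleinBilin_self_ne_zero h2 hB X.rep.2 hX0
  have hY := hE.symm.kleinBilin_self_ne_zero h2 hB Y.rep.2 hY0
  have hXY := hE.kleinBilin_eq_zero h2 hB X.rep.2 Y.rep.2
  have hYX := (kleinBilin_comm _ _).trans hXY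
  have hq : ∀ s t : F, kleinForm (s • (X.rep : Fin 6 → F) + t • (Y.rep : Fin 6 → F)) = 0 ↔
      s ^ 2 * kleinBilin F X.rep X.rep + t ^ 2 * kleinBilin F Y.rep Y.rep = 0 := by
    intro s t
    rw [← mul_eq_zero_iff_left h2, ← kleinBilin_self]
    simp only [map_add, map_smul, LinearMap.add_apply, LinearMap.smul_apply, smul_eq_mul, hXY, hYX]
    ring_nf
  simp only [meetsKlein_iff, join_eq_span_pair, Submodule.mem_span_pair]
  constructor
  · rintro ⟨_, ⟨s, t, rfl⟩, h0, h⟩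
    rw [hq] at h
    have ht : t ≠ 0 := by
      rintro rfl
      have hs : s ≠ 0 := by rintro rfl; simp at h0
      simp [hs, hX] at h
    refine ⟨s * kleinBilin F X.rep X.rep / t, ?_⟩
    field_simp
    linear_combination -h
  · rintro ⟨r, hr⟩
    refine ⟨_, ⟨r, kleinBilin F X.rep X.rep, rfl⟩, ?_, ?_⟩
    · intro h0
      have : kleinBilin F X.rep X.rep • (Y.rep : Fin 6 → F) ∈ EL := by
        rw [eq_neg_of_add_eq_zero_right h0]
        exact neg_mem (EL.smul_mem _ X.rep.2)
      exact smul_ne_zero hX hY0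
        (Submodule.disjoint_def.1 hE.skew _ this (ER.smul_mem _ Y.rep.2))
    · rw [hq]
      linear_combination -kleinBilin F X.rep X.rep * hr

/-- Every point of one invariant plane is joined to some point of the other one by a line that
meets the Klein quadric: a plane on the quadric meets the join of the point and the plane. -/
theorem IsInvariantPlanes.exists_meetsKlein_join (hE : IsInvariantPlanes B EL ER)
    (h2 : (2 : F) ≠ 0) (hB : ∀ x, B x x = 0 → x = 0) (Y : ℙ F ER) :
    ∃ X : ℙ F EL, MeetsKlein (join X Y) := by
  have hY0 : (Y.rep : Fin 6 → F) ≠ 0 := by simpa using Y.rep_nonzero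
  have hY := hE.symm.kleinBilin_self_ne_zero h2 hB Y.rep.2 hY0
  have hYE : (Y.rep : Fin 6 → F) ∉ EL := fun h =>
    hY0 (Submodule.disjoint_def.1 hE.skew _ h Y.rep.2)
  let W := EL ⊔ Submodule.span F {(Y.rep : Fin 6 → F)}
  have hW : Module.finrank F W = 4 := by
    have hd : Disjoint EL (Submodule.span F {(Y.rep : Fin 6 → F)}) :=
      hE.skew.mono_right ((Submodule.span_singleton_le_iff_mem _ _).2 Y.rep.2)
    have h := Submodule.finrank_sup_add_finrank_inf_eq EL
      (Submodule.span F {(Y.rep : Fin 6 → F)})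
    rw [hd.eq_bot, finrank_bot, hE.finrank_left, finrank_span_singleton hY0] at h
    exact h
  -- The vectors whose first three coordinates vanish form a plane on Γ; it meets W, which has
  -- dimension four.
  let φ : W →ₗ[F] (Fin 3 → F) :=
    (LinearMap.funLeft F F (Fin.castAdd 3 : Fin 3 → Fin 6)).comp W.subtype
  obtain ⟨w, hw, hw0⟩ : ∃ w ∈ LinearMap.ker φ, w ≠ 0 := by
    apply Submodule.exists_mem_ne_zero_of_ne_bot
    apply LinearMap.ker_ne_bot_of_finrank_lt
    rw [hW]
    simp
  have hw' : ∀ i : Fin 3, (w : Fin 6 → F) (Fin.castAdd 3 i) = 0 := fun i =>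
    congrFun (LinearMap.mem_ker.1 hw) i
  have hwq : kleinForm (w : Fin 6 → F) = 0 := by
    have h0 := hw' 0
    have h1 := hw' 1
    have h2 := hw' 2
    simp only [Fin.isValue, Fin.castAdd, Fin.castLE] at h0 h1 h2
    simp [kleinForm]
    simp_all
  have hw0' : (w : Fin 6 → F) ≠ 0 := by simpa using hw0
  obtain ⟨x, hx, y, hy, hxy⟩ := Submodule.mem_sup.1 w.2
  obtain ⟨t, rfl⟩ := Submodule.mem_span_singleton.1 hy
  -- Otherwise w would be a multiple of Y, which is not on Γ.
  have hx0 : x ≠ 0 := by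
    rintro rfl
    have hq := kleinBilin_self (w : Fin 6 → F)
    have ht : t ≠ 0 := by
      rintro rfl
      apply hw0'
      rw [← hxy]
      simp
    rw [hwq, ← hxy] at hq
    simp [ht, hY] at hq
  refine ⟨Projectivization.mk F ⟨x, hx⟩ (by simpa using hx0), ?_⟩
  rw [meetsKlein_iff]
  refine ⟨w, ?_, hw0', hwq⟩
  rw [← hxy, join, Projectivization.submodule_mk, Y.submodule_eq]
  refine Submodule.add_mem_sup ?_ ?_
  · exact ⟨⟨x, hx⟩, Submodule.mem_span_singleton_self _, rfl⟩
  · exact ⟨t • Y.rep, Submodule.smul_mem _ _ (Submodule.mem_span_singleton_self _), rfl⟩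

theorem mem_inducedPolar_singleton {E : Submodule F (Fin 6 → F)} (X Y : ℙ F E) :
    Y ∈ inducedPolar {X} ↔ kleinBilin F X.rep Y.rep = 0 := by
  simp only [inducedPolar, Set.mem_singleton_iff, forall_eq, Set.mem_ofPred_eq, KleinConj,
    polar_kleinForm, X.submodule_eq, Y.submodule_eq, Submodule.mem_span_singleton]
  constructor
  · intro h
    exact h _ ⟨1, one_smul _ _⟩ _ ⟨1, one_smul _ _⟩
  · rintro h _ ⟨s, rfl⟩ _ ⟨t, rfl⟩
    simp [h]

theorem CommutesWithPolarity.kleinBilin_rep_eq_zero_iff {E : Submodule F (Fin 6 → F)}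
    {g : Equiv.Perm (ℙ F E)} (hg : CommutesWithPolarity g) (X Y : ℙ F E) :
    kleinBilin F (g X).rep (g Y).rep = 0 ↔ kleinBilin F X.rep Y.rep = 0 := by
  rw [← mem_inducedPolar_singleton, ← mem_inducedPolar_singleton, ← Set.image_singleton, ← hg,
    g.injective.mem_set_image]

/-- Collineations that commute with the induced polarity respect the relation of points to have
the same square class. -/
theorem CommutesWithPolarity.isSquare {E : Submodule F (Fin 6 → F)} {g : Equiv.Perm (ℙ F E)}
    (hg : CommutesWithPolarity g) (h2 : (2 : F) ≠ 0) (hd : Module.finrank F E = 3)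
    (hb : ∀ p ∈ E, p ≠ 0 → kleinBilin F p p ≠ 0) {X Y : ℙ F E}
    (h : IsSquare (kleinBilin F X.rep X.rep * kleinBilin F Y.rep Y.rep)) :
    IsSquare (kleinBilin F (g X).rep (g X).rep * kleinBilin F (g Y).rep (g Y).rep) := by
  classical
  -- A lift of g to vectors that is constant on nonzero multiples; it need not be additive.
  let f : E → E := fun v => if hv : v = 0 then 0 else (g (Projectivization.mk F v hv)).rep
  have hf0 : ∀ v (hv : v ≠ 0), f v = (g (Projectivization.mk F v hv)).rep := fun v hv =>
    dif_neg hv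
  have hfr : ∀ X : ℙ F E, f X.rep = (g X).rep := fun X => by
    rw [hf0 _ X.rep_nonzero, X.mk_rep]
  have hc : ∀ (c : F) (v : E), c ≠ 0 → f (c • v) = f v := by
    intro c v hc
    by_cases hv : v = 0
    · rw [hv, smul_zero]
    · rw [hf0 _ (smul_ne_zero hc hv), hf0 _ hv]
      congr 2
      exact (Projectivization.mk_eq_mk_iff' F _ _ _ _).2 ⟨c, rfl⟩
  have hrep : ∀ v : E, v ≠ 0 → ∃ (X : ℙ F E) (c : F), c ≠ 0 ∧ v = c • X.rep := by
    intro v hv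
    obtain ⟨a, ha⟩ := Projectivization.exists_smul_eq_mk_rep F v hv
    refine ⟨Projectivization.mk F v hv, (a⁻¹ : Fˣ), Units.ne_zero _, ?_⟩
    rw [← ha, Units.smul_def, smul_smul, Units.inv_mul, one_smul]
  have hf : ∀ u v, (kleinBilin F).restrict E (f u) (f v) = 0 ↔
      (kleinBilin F).restrict E u v = 0 := by
    intro u v
    by_cases hu : u = 0
    · simp [hu, f]
    by_cases hv : v = 0
    · simp [hv, f]
    obtain ⟨X, c, hc0, rfl⟩ := hrep u hu
    obtain ⟨Y, d, hd0, rfl⟩ := hrep v hv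
    rw [hc _ _ hc0, hc _ _ hd0, hfr, hfr]
    simpa [hc0, hd0] using hg.kleinBilin_rep_eq_zero_iff X Y
  have := isSquare_map_mul_map (b := (kleinBilin F).restrict E) h2 hd
    ⟨fun x y => kleinBilin_comm _ _⟩
    (fun x hx => by
      by_contra hx0
      exact hb x x.2 (by simpa using hx0) hx) hf hc (x := X.rep) (y := Y.rep) h
  rwa [hfr, hfr] at this

theorem CommutesWithPolarity.inv {E : Submodule F (Fin 6 → F)} {g : Equiv.Perm (ℙ F E)}
    (hg : CommutesWithPolarity g) : CommutesWithPolarity g⁻¹ := by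
  intro S
  have h := hg (⇑g⁻¹ '' S)
  rw [show ⇑g '' (⇑g⁻¹ '' S) = S from Equiv.image_symm_image g S] at h
  rw [← h]
  exact Equiv.symm_image_image g _

theorem IsCollineation.inv {E : Submodule F (Fin 6 → F)} {g : Equiv.Perm (ℙ F E)}
    (hg : IsCollineation g) : IsCollineation g⁻¹ := by
  intro l
  rw [← hg, show ⇑g '' (⇑g⁻¹ '' l) = l from Equiv.image_symm_image g l]

end InvariantPlanes

end EllipticSpace

theorem proposition12 {F : Type*} [Field F] (B : LinearMap.BilinForm F (Fin 4 → F))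
    (hB : EllipticSpace.IsClassicalElliptic B)
    (EL ER : Submodule F (Fin 6 → F)) (hE : EllipticSpace.IsInvariantPlanes B EL ER)
    (ζ : Equiv.Perm (ℙ F EL)) (η : Equiv.Perm (ℙ F ER))
    (h : EllipticSpace.Admissible ζ η) :
    EllipticSpace.Admissible ζ⁻¹ η⁻¹ := by
  have h2 : (2 : F) ≠ 0 := Ring.two_ne_zero hB.char_ne_two
  refine ⟨h.collineation_left.inv, h.collineation_right.inv, h.commutes_left.inv,
    h.commutes_right.inv, fun X Y hXY => ?_⟩
  obtain ⟨X₀, hX₀⟩ := hE.exists_meetsKlein_join h2 hB.anisotropic (η⁻¹ Y)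
  have hζX₀ := h.meets _ _ hX₀
  rw [show η (η⁻¹ Y) = Y from η.apply_symm_apply Y] at hζX₀
  have hb := fun p => hE.kleinBilin_self_ne_zero h2 hB.anisotropic (p := p)
  have hb' := fun p => hE.symm.kleinBilin_self_ne_zero h2 hB.anisotropic (p := p)
  have hne : ∀ X : ℙ F EL, EllipticSpace.kleinBilin F X.rep X.rep ≠ 0 := fun X =>
    hb _ X.rep.2 (by simpa using X.rep_nonzero)
  have hne' : ∀ Y : ℙ F ER, EllipticSpace.kleinBilin F Y.rep Y.rep ≠ 0 := fun Y =>
    hb' _ Y.rep.2 (by simpa using Y.rep_nonzero)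
  -- Transitivity of lying in the same square class.
  have cancel : ∀ {a b c : F}, b ≠ 0 → IsSquare (a * b) → IsSquare (b * c) →
      IsSquare (a * c) := by
    rintro a b c hb ⟨r, hr⟩ ⟨s, hs⟩
    refine ⟨r * s / b, ?_⟩
    field_simp
    linear_combination c * b * hr + r ^ 2 * hs
  simp only [hE.meetsKlein_join_iff h2 hB.anisotropic, ← mul_neg] at hXY hX₀ hζX₀ ⊢
  -- X and ζ X₀ both lie in the class of -q(Y), so ζ⁻¹ X and X₀ share a class.
  have key := h.commutes_left.inv.isSquare h2 hE.finrank_left hb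
    (cancel (neg_ne_zero.2 (hne' Y)) hXY (by rwa [mul_comm]))
  rw [show ζ⁻¹ (ζ X₀) = X₀ from ζ.symm_apply_apply X₀] at key
  exact cancel (hne X₀) key hX₀
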